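/- Let $X$ be a compact metric space with metric $d$ and more than one point, and let $T\colon X\to X$ be a continuous map. Assume that (i) $(X,T)$ is transitive: for any two nonempty open sets $U,V\subset X$ there is an integer $n>0$ with $T^n(U)\cap V\neq\emptyset$; and (ii) $(X,T)$ has the shadowing property: for every $\varepsilon>0$ there is $\delta>0$ such that for every sequence $(x_n)_{n\ge 0}$ in $X$ with $d(T(x_n),x_{n+1})<\delta$ for all $n\ge 0$ there is a point $y\in X$ with $d(T^n(y),x_n)<\varepsilon$ for all $n\ge 0$. Let $M_T(X)$ be the space of $T$-invariant Borel probability measures on $X$ with the weak$^*$ topology. Call $\mu\in M_T(X)$ strongly mixing if $\lim_{n\to\infty}\mu(A\cap T^{-n}(B))=\mu(A)\mu(B)$ for all Borel sets $A,B\subset X$. Then the set of strongly mixing measures is of first category in $M_T(X)$, that is, it is a countable union of nowhere dense subsets of $M_T(X)$. -/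

import Mathlib

open Set Filter Topology MeasureTheory

namespace TopDyn

/-- `(X, T)` is (topologically) transitive: for any two nonempty open sets `U, V` there is `n > 0`
such that `T^n(U)` meets `V`. -/
def IsTransitive {X : Type*} [TopologicalSpace X] (T : X → X) : Prop :=
  ∀ U V : Set X, IsOpen U → U.Nonempty → IsOpen V → V.Nonempty →
    ∃ n : ℕ, 0 < n ∧ (T^[n] '' U ∩ V).Nonempty

/-- `x` is a `δ`-pseudo-orbit of `T`. -/
def IsPseudoOrbit {X : Type*} [MetricSpace X] (T : X → X) (δ : ℝ) (x : ℕ → X) : Prop :=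
  ∀ n : ℕ, dist (T (x n)) (x (n + 1)) < δ

/-- The sequence `x` is `ε`-traced by the point `y`. -/
def IsTracedBy {X : Type*} [MetricSpace X] (T : X → X) (ε : ℝ) (x : ℕ → X) (y : X) : Prop :=
  ∀ n : ℕ, dist (T^[n] y) (x n) < ε

/-- The shadowing property: for every `ε > 0` there is `δ > 0` such that every `δ`-pseudo-orbit is
`ε`-traced by some point. -/
def HasShadowing {X : Type*} [MetricSpace X] (T : X → X) : Prop :=
  ∀ ε : ℝ, 0 < ε → ∃ δ : ℝ, 0 < δ ∧
    ∀ x : ℕ → X, IsPseudoOrbit T δ x → ∃ y : X, IsTracedBy T ε x y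

/-- `M_T(X)`: the `T`-invariant Borel probability measures on `X`. As a subtype of
`ProbabilityMeasure X` it carries the topology of weak convergence of measures (the weak-*
topology). -/
def invariantMeasures {X : Type*} [MeasurableSpace X] (T : X → X) : Set (ProbabilityMeasure X) :=
  {μ | MeasurePreserving T (μ : Measure X) (μ : Measure X)}

/-- `μ` is a strongly mixing measure for `T`: it is invariant and
`μ(A ∩ T^{-n}(B)) → μ(A) μ(B)` for all measurable sets `A`, `B`. -/
structure IsStronglyMixing {X : Type*} [MeasurableSpace X] (T : X → X) (μ : Measure X) : Prop where
  measurePreserving : MeasurePreserving T μ μ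
  tendsto_inter : ∀ A B : Set X, MeasurableSet A → MeasurableSet B →
    Tendsto (fun n : ℕ => μ (A ∩ T^[n] ⁻¹' B)) atTop (𝓝 (μ A * μ B))

end TopDyn

/-! If a strongly mixing measure `μ` charges two disjoint closed sets `F` and `G`, then
`ν (F ∩ T⁻ᵏ G)` is bounded below by some `c > 0` for all large `k` when `ν = μ`, and for fixed `c`
and starting time `N` the invariant `ν` with this property form a closed set. On the other hand
`μ` is a limit of almost rigid invariant measures: mixing provides a point that returns close to
itself at a large time `n` and whose Birkhoff average up to `n` is nearly the `μ`-average, shadowing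
the periodic repetition of this orbit segment gives an orbit almost of period `n`, and every
invariant measure carried by its closure is close to `μ` and satisfies `T^[n] z ≈ z` almost
everywhere. Such a measure cannot move a fixed proportion of `F` into `G` at time `n`, so the
mixing measures in the closed set above form a nowhere dense set. Letting `F` and `G` range over
closures of basic open sets covers all the mixing measures that are not Dirac.

The Dirac measures form a closed set, and moving from an invariant Dirac measure towards any other
invariant measure leaves it at once. Transitivity provides the other measure: an orbit segment that
starts and ends near `q`, repeated periodically, is traced by an orbit that visits a neighbourhood
of `q` with bounded gaps, so some invariant measure charges that neighbourhood.
-/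

namespace TopDyn

open scoped BoundedContinuousFunction unitInterval

section MeanErgodic

variable {α 𝕜 : Type*} [MeasurableSpace α] {μ : Measure α} {T : α → α} [RCLike 𝕜]

theorem iterate_compMeasurePreserving_ae_eq {E : Type*} [NormedAddCommGroup E] {p : ENNReal}
    (hT : MeasurePreserving T μ μ) (f : Lp E p μ) (n : ℕ) :
    ⇑((Lp.compMeasurePreserving T hT)^[n] f) =ᵐ[μ] f ∘ T^[n] := by
  rw [Lp.compMeasurePreserving_iterate]
  exact Lp.coeFn_compMeasurePreserving f (hT.iterate n)

theorem birkhoffSum_compMeasurePreserving_ae_eq {E : Type*} [NormedAddCommGroup E] {p : ENNReal}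
    (hT : MeasurePreserving T μ μ) (f : Lp E p μ) (n : ℕ) :
    ⇑(birkhoffSum (Lp.compMeasurePreserving T hT) (id : Lp E p μ → Lp E p μ) n f) =ᵐ[μ]
      birkhoffSum T f n := by
  induction n with
  | zero => exact Lp.coeFn_zero E p μ
  | succ n ih =>
    rw [birkhoffSum_succ]
    filter_upwards [Lp.coeFn_add (birkhoffSum (Lp.compMeasurePreserving T hT) id n f)
      ((Lp.compMeasurePreserving T hT)^[n] f), ih,
      iterate_compMeasurePreserving_ae_eq hT f n] with x hadd hsum hiter
    rw [birkhoffSum_succ, ← hsum, ← Function.comp_apply (f := f), ← hiter]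
    exact hadd

theorem birkhoffAverage_compMeasurePreserving_ae_eq {p : ENNReal} (hT : MeasurePreserving T μ μ)
    (f : Lp 𝕜 p μ) (n : ℕ) :
    ⇑(birkhoffAverage 𝕜 (Lp.compMeasurePreserving T hT) (id : Lp 𝕜 p μ → Lp 𝕜 p μ) n f) =ᵐ[μ]
      birkhoffAverage 𝕜 T f n := by
  filter_upwards [Lp.coeFn_smul (n : 𝕜)⁻¹
    (birkhoffSum (Lp.compMeasurePreserving T hT) id n f),
    birkhoffSum_compMeasurePreserving_ae_eq hT f n] with x hsmul hsum
  rw [birkhoffAverage, birkhoffAverage, hsmul, Pi.smul_apply, hsum]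

theorem compMeasurePreserving_eq_self_iff_of_ergodic [IsFiniteMeasure μ] (hT : Ergodic T μ)
    {p : ENNReal} {f : Lp 𝕜 p μ} :
    Lp.compMeasurePreserving T hT.toMeasurePreserving f = f ↔ ∃ c, f = Lp.const p μ c := by
  constructor
  · intro hf
    obtain ⟨c, hc⟩ := hT.eq_const_of_compMeasurePreserving_eq (congrArg Subtype.val hf)
    exact ⟨c, Subtype.ext hc⟩
  · rintro ⟨c, rfl⟩
    rfl

theorem inner_const_left [IsFiniteMeasure μ] (c : 𝕜) (f : Lp 𝕜 2 μ) :
    inner 𝕜 (Lp.const 2 μ c) f = inner 𝕜 c (∫ x, f x ∂μ) := by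
  rw [← indicatorConstLp_univ, L2.inner_indicatorConstLp_eq_inner_setIntegral, setIntegral_univ]

variable [IsProbabilityMeasure μ]

theorem integral_coe_const {p : ENNReal} (c : 𝕜) : ∫ x, Lp.const p μ c x ∂μ = c := by
  rw [integral_congr_ae (Lp.coeFn_const p μ c)]
  simp only [Function.const_apply, integral_const, probReal_univ, one_smul]

theorem inner_sub_const_integral_const_eq_zero (f : Lp 𝕜 2 μ) (c : 𝕜) :
    inner 𝕜 (f - Lp.const 2 μ (∫ x, f x ∂μ)) (Lp.const 2 μ c) = 0 := by
  rw [inner_eq_zero_symm, inner_sub_right, inner_const_left, inner_const_left, integral_coe_const,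
    sub_self]

theorem orthogonalProjectionOnto_eqLocus_compMeasurePreserving (hT : Ergodic T μ)
    (f : Lp 𝕜 2 μ) :
    ((((Lp.compMeasurePreservingₗᵢ 𝕜 T hT.toMeasurePreserving).toContinuousLinearMap.eqLocus
      (1 : Lp 𝕜 2 μ →L[𝕜] Lp 𝕜 2 μ)).orthogonalProjectionOnto f : Lp 𝕜 2 μ)) =
      Lp.const 2 μ (∫ x, f x ∂μ) := by
  refine Submodule.eq_starProjection_of_mem_of_inner_eq_zero
    ((compMeasurePreserving_eq_self_iff_of_ergodic hT).2 ⟨_, rfl⟩) fun g hg => ?_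
  obtain ⟨c, rfl⟩ := (compMeasurePreserving_eq_self_iff_of_ergodic hT).1 hg
  exact inner_sub_const_integral_const_eq_zero f c

theorem tendstoInMeasure_birkhoffAverage_of_ergodic (hT : Ergodic T μ) {f : α → 𝕜}
    (hf : MemLp f 2 μ) :
    TendstoInMeasure μ (birkhoffAverage 𝕜 T f) atTop fun _ => ∫ x, f x ∂μ := by
  let U := Lp.compMeasurePreservingₗᵢ 𝕜 (E := 𝕜) (p := 2) T hT.toMeasurePreserving
  have hlim := U.toContinuousLinearMap.tendsto_birkhoffAverage_orthogonalProjection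
    U.norm_toContinuousLinearMap_le (hf.toLp f)
  rw [orthogonalProjectionOnto_eqLocus_compMeasurePreserving hT,
    integral_congr_ae hf.coeFn_toLp] at hlim
  refine (tendstoInMeasure_of_tendsto_Lp hlim).congr (fun n => ?_) (Lp.coeFn_const _ _ _)
  exact (birkhoffAverage_compMeasurePreserving_ae_eq hT.toMeasurePreserving _ n).trans
    (hT.quasiMeasurePreserving.birkhoffAverage_ae_eq_of_ae_eq 𝕜 hf.coeFn_toLp n)

end MeanErgodic

section Mixing

variable {α : Type*} [MeasurableSpace α] {μ : Measure α} {T : α → α} [IsProbabilityMeasure μ]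

theorem IsStronglyMixing.ergodic (h : IsStronglyMixing T μ) : Ergodic T μ where
  toMeasurePreserving := h.measurePreserving
  aeconst_set A hA hTA := by
    have hinter (n : ℕ) : A ∩ T^[n] ⁻¹' A = A := by
      rw [Function.IsFixedPt.preimage_iterate hTA n, inter_self]
    have hindep : ProbabilityTheory.IndepSet A A μ := by
      rw [ProbabilityTheory.indepSet_iff_measure_inter_eq_mul hA hA (μ := μ), inter_self]
      simpa only [hinter, tendsto_const_nhds_iff] using h.tendsto_inter A A hA hA
    rw [eventuallyConst_set', ae_eq_empty, ae_eq_univ, prob_compl_eq_zero_iff hA]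
    exact ProbabilityTheory.measure_eq_zero_or_one_of_indepSet_self hindep

theorem IsStronglyMixing.exists_recurrent_forall_dist_birkhoffAverage_lt {𝕜 ι : Type*} [RCLike 𝕜]
    (h : IsStronglyMixing T μ) {A : Set α} (hA : MeasurableSet A) (hμA : μ A ≠ 0)
    (F : Finset ι) {f : ι → α → 𝕜} (hf : ∀ i ∈ F, MemLp (f i) 2 μ) {η : ℝ} (hη : 0 < η) (N : ℕ) :
    ∃ n ≥ N, ∃ x ∈ A, T^[n] x ∈ A ∧
      ∀ i ∈ F, dist (birkhoffAverage 𝕜 T (f i) n x) (∫ z, f i z ∂μ) < η := by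
  let bad (n : ℕ) (i : ι) : Set α :=
    {x | η ≤ dist (birkhoffAverage 𝕜 T (f i) n x) (∫ z, f i z ∂μ)}
  have hbad : Tendsto (fun n => ∑ i ∈ F, μ (bad n i)) atTop (𝓝 0) := by
    simpa only [Finset.sum_const_zero] using tendsto_finsetSum F fun i hi =>
      tendstoInMeasure_iff_dist.1
        (tendstoInMeasure_birkhoffAverage_of_ergodic h.ergodic (hf i hi)) η hη
  obtain ⟨n, hlt, hn⟩ := ((hbad.eventually_lt (h.tendsto_inter A A hA hA)
    (pos_iff_ne_zero.2 (mul_ne_zero hμA hμA))).and (eventually_ge_atTop N)).exists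
  obtain ⟨x, ⟨hxA, hTxA⟩, hx⟩ := not_subset.1 fun hsub : A ∩ T^[n] ⁻¹' A ⊆ ⋃ i ∈ F, bad n i =>
    hlt.not_ge ((measure_mono hsub).trans (measure_biUnion_finset_le F (bad n)))
  refine ⟨n, hn, x, hxA, hTxA, fun i hi => ?_⟩
  by_contra! hge
  exact hx (mem_iUnion₂.2 ⟨i, hi, hge⟩)

end Mixing

section KrylovBogoliubov

variable {X : Type*} [MeasurableSpace X] {T : X → X}

/-- The uniform probability measure on the first `n + 1` points of the orbit of `y`, counted with
multiplicity; its limit points as `n → ∞` are invariant. -/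
noncomputable def empiricalMeasure (T : X → X) (y : X) (n : ℕ) :
    ProbabilityMeasure X :=
  ⟨((n + 1 : ℕ) : ENNReal)⁻¹ • ∑ i ∈ Finset.range (n + 1), Measure.dirac (T^[i] y), ⟨by
    simp [ENNReal.inv_mul_cancel]⟩⟩

theorem empiricalMeasure_eq_one {y : X} {C : Set X}
    (hC : MeasurableSet C) (hy : ∀ i, T^[i] y ∈ C) (n : ℕ) :
    (empiricalMeasure T y n : Measure X) C = 1 := by
  simp [empiricalMeasure, hC, hy, ENNReal.inv_mul_cancel]

variable [TopologicalSpace X]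

theorem isClosed_setOf_le_measure [OpensMeasurableSpace X] [HasOuterApproxClosed X] {C : Set X}
    (hC : IsClosed C) (c : ENNReal) :
    IsClosed {μ : ProbabilityMeasure X | c ≤ (μ : Measure X) C} := by
  refine isClosed_iff_ultrafilter.2 fun μ u hu hcu => ?_
  exact (le_limsup_of_frequently_le' (Eventually.frequently hcu)).trans
    (ProbabilityMeasure.limsup_measure_closed_le_of_tendsto (μs := id) hu hC)

theorem integral_empiricalMeasure [OpensMeasurableSpace X] [MeasurableSingletonClass X]
    (T : X → X) (y : X) (n : ℕ) (g : X →ᵇ ℝ) :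
    ∫ x, g x ∂(empiricalMeasure T y n : Measure X) = birkhoffAverage ℝ T g (n + 1) y := by
  simp only [empiricalMeasure, ProbabilityMeasure.coe_mk, integral_smul_measure,
    integral_finsetSum_measure fun i _ => g.integrable (Measure.dirac (T^[i] y)),
    birkhoffAverage, birkhoffSum, integral_dirac, ENNReal.toReal_inv, ENNReal.toReal_natCast]

variable [BorelSpace X] [HasOuterApproxClosed X]

theorem measurePreserving_of_forall_integral_comp_eq (hT : Continuous T) {ν : Measure X}
    [IsFiniteMeasure ν] (h : ∀ g : X →ᵇ ℝ, ∫ x, g (T x) ∂ν = ∫ x, g x ∂ν) :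
    MeasurePreserving T ν ν := by
  have := ν.isFiniteMeasure_map T
  refine ⟨hT.measurable, ext_of_forall_integral_eq_of_IsFiniteMeasure fun g => ?_⟩
  rw [integral_map hT.aemeasurable g.continuous.aestronglyMeasurable, h]

theorem mem_invariantMeasures_of_tendsto_empiricalMeasure [T1Space X] (hT : Continuous T) {y : X}
    {ν : ProbabilityMeasure X} {l : Filter ℕ} [l.NeBot] (hl : l ≤ atTop)
    (hν : Tendsto (empiricalMeasure T y) l (𝓝 ν)) : ν ∈ invariantMeasures T := by
  refine measurePreserving_of_forall_integral_comp_eq hT fun g => ?_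
  have havg (f : X →ᵇ ℝ) : Tendsto (fun n => birkhoffAverage ℝ T f (n + 1) y) l
      (𝓝 (∫ x, f x ∂(ν : Measure X))) := by
    simpa only [integral_empiricalMeasure] using
      ProbabilityMeasure.tendsto_iff_forall_integral_tendsto.1 hν f
  have hcomp (n : ℕ) : birkhoffAverage ℝ T (g.compContinuous ⟨T, hT⟩) n y =
      birkhoffAverage ℝ T g n (T y) := by
    simp only [birkhoffAverage, birkhoffSum, BoundedContinuousFunction.compContinuous_apply,
      ContinuousMap.coe_mk, ← Function.iterate_succ_apply, ← Function.iterate_succ_apply' T]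
  have hzero := ((tendsto_birkhoffAverage_apply_sub_birkhoffAverage' ℝ g.isBounded_range T y).comp
    (tendsto_add_atTop_nat 1)).mono_left hl
  refine sub_eq_zero.1 (tendsto_nhds_unique ((havg (g.compContinuous ⟨T, hT⟩)).sub (havg g)) ?_)
  simpa only [hcomp, Function.comp_def] using hzero

theorem exists_mem_invariantMeasures_of_orbit [T2Space X] [CompactSpace X] (hT : Continuous T)
    (y : X) :
    ∃ ν ∈ invariantMeasures T, ∀ C : Set X, IsClosed C → (∀ i, T^[i] y ∈ C) →
      ∀ᵐ z ∂(ν : Measure X), z ∈ C := by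
  obtain ⟨ν, -, hν⟩ := isCompact_univ.ultrafilter_le_nhds
    ((hyperfilter ℕ).map (empiricalMeasure T y)) (by simp only [principal_univ, le_top])
  refine ⟨ν, mem_invariantMeasures_of_tendsto_empiricalMeasure hT Nat.hyperfilter_le_atTop hν,
    fun C hC hy => ?_⟩
  have hle : 1 ≤ (ν : Measure X) C := (isClosed_setOf_le_measure hC 1).mem_of_tendsto hν <|
    .of_forall fun n => (empiricalMeasure_eq_one hC.measurableSet hy n).ge
  exact (mem_ae_iff_prob_eq_one hC.measurableSet).2 (one_le_prob_iff.1 hle)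

end KrylovBogoliubov

theorem sum_range_add_eq_of_periodic {M : Type*} [AddCommMonoid M] {u : ℕ → M} {n : ℕ}
    (hu : Function.Periodic u n) (j : ℕ) :
    ∑ i ∈ Finset.range n, u (i + j) = ∑ i ∈ Finset.range n, u i := by
  induction j with
  | zero => rfl
  | succ j ih =>
    cases n with
    | zero => rfl
    | succ m =>
      rw [← ih, Finset.sum_range_succ, Finset.sum_range_succ', zero_add,
        ← add_assoc m j 1, add_right_comm m j 1, add_comm (m + 1) j, hu j]
      simp only [add_assoc, add_comm j 1]

section BirkhoffIntegral

variable {α E : Type*} [MeasurableSpace α] {μ : Measure α} {T : α → α} [NormedAddCommGroup E]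
  [NormedSpace ℝ E] {f : α → E}

theorem integrable_birkhoffAverage (hT : MeasurePreserving T μ μ) (hf : Integrable f μ) (n : ℕ) :
    Integrable (birkhoffAverage ℝ T f n) μ :=
  (integrable_finsetSum _ fun i _ => (hT.iterate i).integrable_comp_of_integrable hf).smul _

theorem integral_birkhoffAverage (hT : MeasurePreserving T μ μ) (hf : Integrable f μ) {n : ℕ}
    (hn : n ≠ 0) : ∫ x, birkhoffAverage ℝ T f n x ∂μ = ∫ x, f x ∂μ := by
  have hiter (i : ℕ) : ∫ x, f (T^[i] x) ∂μ = ∫ x, f x ∂μ := by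
    have hmap := (hT.iterate i).map_eq
    conv_rhs => rw [← hmap]
    exact (integral_map (hT.iterate i).aemeasurable (hmap.symm ▸ hf.aestronglyMeasurable)).symm
  simp only [birkhoffAverage, birkhoffSum]
  rw [integral_smul, integral_finsetSum (f := fun i x => f (T^[i] x)) _
    fun i _ => (hT.iterate i).integrable_comp_of_integrable hf]
  simp only [hiter, Finset.sum_const, Finset.card_range]
  rw [← Nat.cast_smul_eq_nsmul ℝ, inv_smul_smul₀ (Nat.cast_ne_zero.2 hn)]

end BirkhoffIntegral

section Shadowing

variable {X : Type*} [MetricSpace X] {T : X → X}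

theorem HasShadowing.exists_isTracedBy_mod (h : HasShadowing T) {ε : ℝ} (hε : 0 < ε) :
    ∃ δ > 0, ∀ (x : X) (n : ℕ), n ≠ 0 → dist (T^[n] x) x < δ →
      ∃ y, IsTracedBy T ε (fun j => T^[j % n] x) y := by
  obtain ⟨δ, hδ, htrace⟩ := h ε hε
  refine ⟨δ, hδ, fun x n hn hx => htrace _ fun j => ?_⟩
  rw [← Function.iterate_succ_apply' T, Nat.succ_eq_add_one, ← Nat.mod_add_mod]
  obtain hlt | heq := (Nat.succ_le_of_lt (Nat.mod_lt j (Nat.pos_of_ne_zero hn))).lt_or_eq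
  · rwa [Nat.mod_eq_of_lt hlt, dist_self]
  · rwa [show j % n + 1 = n from heq, Nat.mod_self]

variable {x y : X} {n : ℕ} {ε : ℝ}

theorem IsTracedBy.dist_birkhoffAverage_le {E : Type*} [NormedAddCommGroup E] [NormedSpace ℝ E]
    (hy : IsTracedBy T ε (fun j => T^[j % n] x) y) {g : X → E} {η : ℝ}
    (hη : 0 ≤ η) (hg : ∀ a b, dist a b < ε → dist (g a) (g b) ≤ η) (j : ℕ) :
    dist (birkhoffAverage ℝ T g n (T^[j] y)) (birkhoffAverage ℝ T g n x) ≤ η := by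
  have hperiodic : Function.Periodic (fun i => g (T^[i % n] x)) n := fun i => by
    simp only [Nat.add_mod_right]
  have hrotate : birkhoffSum T g n x = ∑ i ∈ Finset.range n, g (T^[(i + j) % n] x) := by
    rw [sum_range_add_eq_of_periodic hperiodic]
    exact Finset.sum_congr rfl fun i hi => by rw [Nat.mod_eq_of_lt (Finset.mem_range.1 hi)]
  have hsum : dist (birkhoffSum T g n (T^[j] y)) (birkhoffSum T g n x) ≤ n * η := by
    rw [hrotate, birkhoffSum]
    refine (dist_sum_sum_le_of_le _ fun i _ => ?_).trans_eq
      (by rw [Finset.sum_const, Finset.card_range, nsmul_eq_mul])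
    rw [← Function.iterate_add_apply]
    exact hg _ _ (hy _)
  rw [birkhoffAverage, birkhoffAverage, dist_smul₀, norm_inv, Real.norm_natCast]
  exact inv_mul_le_of_le_mul₀ n.cast_nonneg hη hsum

theorem IsTracedBy.dist_iterate_le (hy : IsTracedBy T ε (fun j => T^[j % n] x) y) (j : ℕ) :
    dist (T^[n] (T^[j] y)) (T^[j] y) ≤ 2 * ε := by
  have hshift : dist (T^[n + j] y) (T^[(n + j) % n] x) < ε := hy (n + j)
  rw [Nat.add_mod_left, Function.iterate_add_apply] at hshift
  linarith [hy j, dist_triangle_right (T^[n] (T^[j] y)) (T^[j] y) (T^[j % n] x)]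

variable [CompactSpace X] [MeasurableSpace X] [BorelSpace X]

theorem IsTracedBy.exists_mem_invariantMeasures (hT : Continuous T) (hn : n ≠ 0)
    (hy : IsTracedBy T ε (fun j => T^[j % n] x) y) :
    ∃ ν ∈ invariantMeasures T, (∀ᵐ z ∂(ν : Measure X), dist (T^[n] z) z ≤ 2 * ε) ∧
      ∀ (g : X →ᵇ ℝ) (η : ℝ), 0 ≤ η → (∀ a b, dist a b < ε → dist (g a) (g b) ≤ η) →
        dist (∫ z, g z ∂(ν : Measure X)) (birkhoffAverage ℝ T g n x) ≤ η := by
  obtain ⟨ν, hinv, hν⟩ := exists_mem_invariantMeasures_of_orbit hT y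
  refine ⟨ν, hinv, hν _ (isClosed_le ((hT.iterate n).dist continuous_id) continuous_const)
    hy.dist_iterate_le, fun g η hη hg => ?_⟩
  have hcont : Continuous (birkhoffAverage ℝ T g n) :=
    (continuous_finsetSum _ fun i _ => g.continuous.comp (hT.iterate i)).const_smul (n : ℝ)⁻¹
  have hae := hν _ (isClosed_le (hcont.dist continuous_const) continuous_const)
    (hy.dist_birkhoffAverage_le hη hg)
  have hle := norm_integral_le_of_norm_le_const
    (f := fun z => birkhoffAverage ℝ T g n z - birkhoffAverage ℝ T g n x) hae
  have hint := g.integrable (ν : Measure X)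
  rw [integral_sub (integrable_birkhoffAverage hinv hint n) (integrable_const _),
    integral_birkhoffAverage hinv hint hn] at hle
  simpa only [integral_const, probReal_univ, one_smul, mul_one, ← dist_eq_norm] using hle

end Shadowing

section AlmostRigid

theorem mem_closure_of_forall_dist_integral_lt {X : Type*} [TopologicalSpace X] [MeasurableSpace X]
    [OpensMeasurableSpace X] {S : Set (ProbabilityMeasure X)} {μ : ProbabilityMeasure X}
    (h : ∀ (F : Finset (X →ᵇ ℝ)) (η : ℝ), 0 < η → ∃ ν ∈ S, ∀ g ∈ F,
      dist (∫ x, g x ∂(ν : Measure X)) (∫ x, g x ∂(μ : Measure X)) < η) :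
    μ ∈ closure S := by
  classical
  choose ν hνS hν using fun i : Finset (X →ᵇ ℝ) × ℕ => h i.1 (1 / (i.2 + 1)) (by positivity)
  refine mem_closure_of_tendsto (f := ν) (b := atTop) ?_ (.of_forall hνS)
  refine ProbabilityMeasure.tendsto_iff_forall_integral_tendsto.2 fun g => ?_
  rw [tendsto_iff_dist_tendsto_zero]
  have hzero : Tendsto (fun i : Finset (X →ᵇ ℝ) × ℕ => 1 / ((i.2 : ℝ) + 1)) atTop (𝓝 0) := by
    rw [← prod_atTop_atTop_eq]
    exact tendsto_one_div_add_atTop_nhds_zero_nat.comp tendsto_snd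
  refine squeeze_zero' (.of_forall fun _ => dist_nonneg) ?_ hzero
  filter_upwards [eventually_ge_atTop ({g}, 0)] with i hi
  exact (hν i g (hi.1 (Finset.mem_singleton_self g))).le

theorem exists_forall_dist_lt_of_finset {X E : Type*} [PseudoMetricSpace X] [CompactSpace X]
    [PseudoMetricSpace E] (F : Finset (X →ᵇ E)) {η : ℝ} (hη : 0 < η) :
    ∃ r > 0, ∀ g ∈ F, ∀ a b, dist a b < r → dist (g a) (g b) < η := by
  have hunif : ∀ᶠ p : X × X in uniformity X, ∀ g ∈ F, dist (g p.1) (g p.2) < η :=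
    (Filter.eventually_all_finset F).2 fun g _ =>
      CompactSpace.uniformContinuous_of_continuous g.continuous (Metric.dist_mem_uniformity hη)
  obtain ⟨r, hr, hF⟩ := Metric.mem_uniformity_dist.1 hunif
  exact ⟨r, hr, fun g hg a b hab => hF hab g hg⟩

variable {X : Type*} [MetricSpace X] [MeasurableSpace X] {T : X → X}

/-- The invariant measures for which a single iterate `T^[k]`, with `k ≥ N`, moves almost every
point by less than `ε`: a quantitative form of rigidity. -/
def almostRigidMeasures (T : X → X) (ε : ℝ) (N : ℕ) : Set (invariantMeasures T) :=
  {ν | ∃ k ≥ N, ∀ᵐ z ∂((ν : ProbabilityMeasure X) : Measure X), dist (T^[k] z) z < ε}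

variable [CompactSpace X] [BorelSpace X] {μ : ProbabilityMeasure X}

theorem IsStronglyMixing.exists_dist_iterate_lt_forall_dist_birkhoffAverage_lt
    (h : IsStronglyMixing T (μ : Measure X)) (F : Finset (X →ᵇ ℝ)) {η δ : ℝ} (hη : 0 < η)
    (hδ : 0 < δ) (N : ℕ) :
    ∃ n ≥ N, ∃ x, dist (T^[n] x) x < δ ∧
      ∀ g ∈ F, dist (birkhoffAverage ℝ T g n x) (∫ z, g z ∂(μ : Measure X)) < η := by
  obtain ⟨p, hp⟩ := (μ : Measure X).nonempty_support (IsProbabilityMeasure.ne_zero _)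
  have hball := (Measure.mem_support_iff_forall p).1 hp _ (Metric.ball_mem_nhds p (half_pos hδ))
  obtain ⟨n, hn, x, hx, hTx, havg⟩ := h.exists_recurrent_forall_dist_birkhoffAverage_lt
    measurableSet_ball hball.ne' F (fun g _ => g.memLp_top.mono_exponent le_top) hη N
  refine ⟨n, hn, x, ?_, havg⟩
  linarith [dist_triangle_right (T^[n] x) x p, Metric.mem_ball.1 hx, Metric.mem_ball.1 hTx]

theorem IsStronglyMixing.exists_mem_almostRigidMeasures
    (h : IsStronglyMixing T (μ : Measure X)) (hT : Continuous T) (hshadow : HasShadowing T)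
    {ε : ℝ} (hε : 0 < ε) (N : ℕ) (F : Finset (X →ᵇ ℝ)) {η : ℝ} (hη : 0 < η) :
    ∃ ν ∈ almostRigidMeasures T ε N, ∀ g ∈ F,
      dist (∫ x, g x ∂((ν : ProbabilityMeasure X) : Measure X))
        (∫ x, g x ∂(μ : Measure X)) < η := by
  obtain ⟨r, hr, hF⟩ := exists_forall_dist_lt_of_finset F (half_pos hη)
  obtain ⟨δ, hδ, hclose⟩ := hshadow.exists_isTracedBy_mod (ε := min r (ε / 3)) (by positivity)
  obtain ⟨n, hn, x, hx, havg⟩ :=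
    h.exists_dist_iterate_lt_forall_dist_birkhoffAverage_lt F (half_pos hη) hδ (N + 1)
  obtain ⟨y, hy⟩ := hclose x n (by omega) hx
  obtain ⟨ν, hν, hret, hint⟩ := hy.exists_mem_invariantMeasures hT (by omega)
  refine ⟨⟨ν, hν⟩, ⟨n, by omega, hret.mono fun z hz => ?_⟩, fun g hg => ?_⟩
  · linarith [min_le_right r (ε / 3)]
  · have hνx := hint g (η / 2) (half_pos hη).le fun a b hab =>
      (hF g hg a b (hab.trans_le (min_le_left _ _))).le
    linarith [havg g hg, dist_triangle (∫ z, g z ∂(ν : Measure X)) (birkhoffAverage ℝ T g n x)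
      (∫ z, g z ∂(μ : Measure X))]

theorem IsStronglyMixing.mem_closure_almostRigidMeasures {μ : invariantMeasures T}
    (h : IsStronglyMixing T ((μ : ProbabilityMeasure X) : Measure X)) (hT : Continuous T)
    (hshadow : HasShadowing T) {ε : ℝ} (hε : 0 < ε) (N : ℕ) :
    μ ∈ closure (almostRigidMeasures T ε N) := by
  refine closure_subtype.2 (mem_closure_of_forall_dist_integral_lt fun F η hη => ?_)
  obtain ⟨ν, hν, hint⟩ := h.exists_mem_almostRigidMeasures hT hshadow hε N F hη
  exact ⟨ν, mem_image_of_mem _ hν, hint⟩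

end AlmostRigid

theorem isNowhereDense_inter_of_subset_closure {Y : Type*} [TopologicalSpace Y] {K R S : Set Y}
    (hK : IsClosed K) (hSR : S ⊆ closure R) (hKR : Disjoint K R) : IsNowhereDense (K ∩ S) := by
  have hdisj : Disjoint (interior (closure (K ∩ S))) (closure R) :=
    ((hKR.mono_left (closure_minimal inter_subset_left hK)).mono_left
      interior_subset).closure_right isOpen_interior
  have hsub : interior (closure (K ∩ S)) ⊆ closure R :=
    interior_subset.trans (closure_minimal (inter_subset_right.trans hSR) isClosed_closure)
  exact disjoint_self.1 (hdisj.mono_right hsub)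

section Correlation

variable {X : Type*} [MeasurableSpace X] {T : X → X}

/-- The invariant measures that send at least mass `c` from `F` into `G` at every time `k ≥ N`. A
strongly mixing measure charging `F` and `G` has this property for some `c > 0` and `N`. -/
def correlatedMeasures (T : X → X) (F G : Set X) (c : ENNReal) (N : ℕ) :
    Set (invariantMeasures T) :=
  {μ | ∀ k ≥ N, c ≤ ((μ : ProbabilityMeasure X) : Measure X) (F ∩ T^[k] ⁻¹' G)}

theorem isClosed_correlatedMeasures [TopologicalSpace X] [OpensMeasurableSpace X]
    [HasOuterApproxClosed X] (hT : Continuous T) {F G : Set X} (hF : IsClosed F)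
    (hG : IsClosed G) (c : ENNReal) (N : ℕ) : IsClosed (correlatedMeasures T F G c N) := by
  simp only [correlatedMeasures, ofPred_forall]
  exact isClosed_iInter fun k => isClosed_iInter fun _ =>
    (isClosed_setOf_le_measure (hF.inter (hG.preimage (hT.iterate k))) c).preimage
      continuous_subtype_val

theorem IsStronglyMixing.exists_mem_correlatedMeasures {μ : invariantMeasures T}
    (h : IsStronglyMixing T ((μ : ProbabilityMeasure X) : Measure X)) {F G : Set X}
    (hF : MeasurableSet F) (hG : MeasurableSet G)
    (hμF : ((μ : ProbabilityMeasure X) : Measure X) F ≠ 0)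
    (hμG : ((μ : ProbabilityMeasure X) : Measure X) G ≠ 0) :
    ∃ m N : ℕ, μ ∈ correlatedMeasures T F G (m : ENNReal)⁻¹ N := by
  obtain ⟨m, hm⟩ := ENNReal.exists_inv_nat_lt (mul_ne_zero hμF hμG)
  exact ⟨m, eventually_atTop.1 ((h.tendsto_inter F G hF hG).eventually_const_le hm)⟩

end Correlation

section Meagre

variable {X : Type*} [MetricSpace X] [MeasurableSpace X] {T : X → X} {F G : Set X}

theorem disjoint_correlatedMeasures_almostRigidMeasures {ε : ℝ}
    (hFG : ∀ x ∈ F, ∀ y ∈ G, ε ≤ dist y x) {c : ENNReal} (hc : c ≠ 0) (N : ℕ) :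
    Disjoint (correlatedMeasures T F G c N) (almostRigidMeasures T ε N) := by
  refine disjoint_left.2 fun ν hcor ⟨k, hk, hrigid⟩ => hc (le_bot_iff.1 ?_)
  refine (hcor k hk).trans_eq (measure_mono_null (fun z hz => ?_) hrigid)
  exact (hFG z hz.1 _ hz.2).not_gt

variable [CompactSpace X] [BorelSpace X]

theorem isMeagre_setOf_isStronglyMixing_of_disjoint (hT : Continuous T) (hshadow : HasShadowing T)
    (hF : IsClosed F) (hG : IsClosed G) (hFG : Disjoint F G) :
    IsMeagre {μ : invariantMeasures T |
      IsStronglyMixing T ((μ : ProbabilityMeasure X) : Measure X) ∧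
        ((μ : ProbabilityMeasure X) : Measure X) F ≠ 0 ∧
        ((μ : ProbabilityMeasure X) : Measure X) G ≠ 0} := by
  obtain ⟨ε, hε, hdisj⟩ := hFG.exists_thickenings hF.isCompact hG
  have hsep (x) (hx : x ∈ F) (y) (hy : y ∈ G) : ε ≤ dist y x := by
    by_contra! hlt
    exact disjoint_left.1 hdisj (Metric.mem_thickening_iff.2 ⟨x, hx, hlt⟩)
      (Metric.self_subset_thickening hε G hy)
  have hnd (m N : ℕ) : IsNowhereDense (correlatedMeasures T F G (m : ENNReal)⁻¹ N ∩
      {μ | IsStronglyMixing T ((μ : ProbabilityMeasure X) : Measure X)}) :=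
    isNowhereDense_inter_of_subset_closure (isClosed_correlatedMeasures hT hF hG _ N)
      (fun _ hμ => IsStronglyMixing.mem_closure_almostRigidMeasures hμ hT hshadow hε N)
      (disjoint_correlatedMeasures_almostRigidMeasures hsep
        (ENNReal.inv_ne_zero.2 (ENNReal.natCast_ne_top m)) N)
  refine IsMeagre.mono ?_ (isMeagre_iUnion fun m : ℕ => isMeagre_iUnion fun N : ℕ =>
    (hnd m N).isMeagre)
  rintro μ ⟨hmix, hμF, hμG⟩
  obtain ⟨m, N, hμ⟩ := hmix.exists_mem_correlatedMeasures hF.measurableSet hG.measurableSet hμF hμG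
  exact mem_iUnion₂.2 ⟨m, N, hμ, hmix⟩

end Meagre

section Dirac

theorem eq_diracProba_of_ae_eq {Ω : Type*} [MeasurableSpace Ω] {μ : ProbabilityMeasure Ω} {p : Ω}
    (h : ∀ᵐ x ∂(μ : Measure Ω), x = p) : μ = diracProba p := by
  refine Subtype.ext ?_
  calc (μ : Measure Ω) = (μ : Measure Ω).map id := Measure.map_id.symm
    _ = (μ : Measure Ω).map fun _ => p := Measure.map_congr h
    _ = Measure.dirac p := by rw [Measure.map_const, measure_univ, one_smul]

theorem exists_mem_countableBasis_of_notMem_range_diracProba {X : Type*} [TopologicalSpace X]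
    [T25Space X] [SecondCountableTopology X] [MeasurableSpace X] {μ : ProbabilityMeasure X}
    (hμ : μ ∉ range diracProba) :
    ∃ U ∈ TopologicalSpace.countableBasis X, ∃ V ∈ TopologicalSpace.countableBasis X,
      Disjoint (closure U) (closure V) ∧ (μ : Measure X) U ≠ 0 ∧ (μ : Measure X) V ≠ 0 := by
  have hbasis := TopologicalSpace.isBasis_countableBasis X
  obtain ⟨p, hp⟩ := (μ : Measure X).nonempty_support (IsProbabilityMeasure.ne_zero _)
  obtain ⟨q, hq, hqp⟩ : ∃ q ∈ (μ : Measure X).support, q ≠ p := by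
    by_contra! hall
    exact hμ ⟨p, (eq_diracProba_of_ae_eq (mem_of_superset Measure.support_mem_ae hall)).symm⟩
  obtain ⟨U', hpU', hU', V', hqV', hV', hdisj⟩ := exists_open_nhds_disjoint_closure hqp.symm
  obtain ⟨U, hU, hpU, hUU'⟩ := hbasis.exists_subset_of_mem_open hpU' hU'
  obtain ⟨V, hV, hqV, hVV'⟩ := hbasis.exists_subset_of_mem_open hqV' hV'
  exact ⟨U, hU, V, hV, hdisj.mono (closure_mono hUU') (closure_mono hVV'),
    ((Measure.mem_support_iff_forall p).1 hp U ((hbasis.isOpen hU).mem_nhds hpU)).ne',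
    ((Measure.mem_support_iff_forall q).1 hq V ((hbasis.isOpen hV).mem_nhds hqV)).ne'⟩

theorem isMeagre_setOf_isStronglyMixing_notMem_range_diracProba {X : Type*}
    [MetricSpace X] [CompactSpace X] [MeasurableSpace X] [BorelSpace X] {T : X → X}
    (hT : Continuous T) (hshadow : HasShadowing T) :
    IsMeagre {μ : invariantMeasures T |
      IsStronglyMixing T ((μ : ProbabilityMeasure X) : Measure X) ∧
        (μ : ProbabilityMeasure X) ∉ range diracProba} := by
  have hcount := TopologicalSpace.countable_countableBasis X
  refine IsMeagre.mono ?_ (isMeagre_biUnion hcount fun U _ => isMeagre_biUnion hcount fun V _ =>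
    isMeagre_iUnion fun hUV : Disjoint (closure U) (closure V) =>
      isMeagre_setOf_isStronglyMixing_of_disjoint hT hshadow isClosed_closure isClosed_closure hUV)
  rintro μ ⟨hmix, hdirac⟩
  obtain ⟨U, hU, V, hV, hUV, hμU, hμV⟩ :=
    exists_mem_countableBasis_of_notMem_range_diracProba hdirac
  refine mem_iUnion₂.2 ⟨U, hU, mem_iUnion₂.2 ⟨V, hV, mem_iUnion.2 ⟨hUV, hmix, ?_, ?_⟩⟩⟩
  · exact fun hzero => hμU (measure_mono_null subset_closure hzero)
  · exact fun hzero => hμV (measure_mono_null subset_closure hzero)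

end Dirac

section Segment

variable {Ω : Type*} [MeasurableSpace Ω]

/-- The point `(1 - t) • μ + t • ν` of the segment from `μ` to `ν` in the space of probability
measures, used to move a Dirac measure off the set of Dirac measures. -/
noncomputable def segmentMeasure (μ ν : ProbabilityMeasure Ω) (t : I) : ProbabilityMeasure Ω :=
  ⟨unitInterval.toNNReal (σ t) • (μ : Measure Ω) + unitInterval.toNNReal t • (ν : Measure Ω), ⟨by
    simp only [Measure.add_apply, Measure.smul_apply, measure_univ, ENNReal.smul_def, smul_eq_mul,
      mul_one, ← ENNReal.coe_add, unitInterval.toNNReal_symm_add_toNNReal, ENNReal.coe_one]⟩⟩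

theorem segmentMeasure_zero (μ ν : ProbabilityMeasure Ω) : segmentMeasure μ ν 0 = μ :=
  Subtype.ext (by simp [segmentMeasure])

theorem continuous_segmentMeasure [TopologicalSpace Ω] [OpensMeasurableSpace Ω]
    (μ ν : ProbabilityMeasure Ω) : Continuous (segmentMeasure μ ν) := by
  rw [(ProbabilityMeasure.toFiniteMeasure_isEmbedding Ω).continuous_iff]
  have hcont : Continuous fun t : I => unitInterval.toNNReal (σ t) • μ.toFiniteMeasure +
      unitInterval.toNNReal t • ν.toFiniteMeasure := by fun_prop
  exact hcont

theorem segmentMeasure_mem_invariantMeasures {T : Ω → Ω} {μ ν : ProbabilityMeasure Ω}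
    (hμ : μ ∈ invariantMeasures T) (hν : ν ∈ invariantMeasures T) (t : I) :
    segmentMeasure μ ν t ∈ invariantMeasures T :=
  (MeasurePreserving.smul_measure hμ _).add_measure (MeasurePreserving.smul_measure hν _)

theorem eq_of_segmentMeasure_mem_range_diracProba [MeasurableSingletonClass Ω]
    {μ ν : ProbabilityMeasure Ω} {t : I} (ht0 : t ≠ 0) (ht1 : t ≠ 1)
    (h : segmentMeasure μ ν t ∈ range diracProba) : μ = ν := by
  obtain ⟨q, hq⟩ := h
  have hae : ∀ᵐ x ∂(segmentMeasure μ ν t : Measure Ω), x = q := by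
    rw [← hq]
    exact (ae_dirac_iff (measurableSet_singleton q)).2 rfl
  obtain ⟨hμ, hν⟩ := ae_add_measure_iff.1 hae
  have hσt : unitInterval.toNNReal (σ t) ≠ 0 := by
    simpa only [ne_eq, ← NNReal.coe_eq_zero, unitInterval.coe_toNNReal, Icc.coe_eq_zero,
      unitInterval.symm_eq_zero] using ht1
  have ht : unitInterval.toNNReal t ≠ 0 := by
    simpa only [ne_eq, ← NNReal.coe_eq_zero, unitInterval.coe_toNNReal,
      Icc.coe_eq_zero] using ht0
  rw [Measure.ae_smul_measure_iff hσt] at hμ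
  rw [Measure.ae_smul_measure_iff ht] at hν
  rw [eq_diracProba_of_ae_eq hμ, eq_diracProba_of_ae_eq hν]

end Segment

theorem isNowhereDense_setOf_mem_range_diracProba {X : Type*} [TopologicalSpace X] [T2Space X]
    [CompactSpace X] [MeasurableSpace X] [BorelSpace X] [HasOuterApproxClosed X] {T : X → X}
    (hne : ∀ p, invariantMeasures T ≠ {diracProba p}) :
    IsNowhereDense {μ : invariantMeasures T | (μ : ProbabilityMeasure X) ∈ range diracProba} := by
  set D := {μ : invariantMeasures T | (μ : ProbabilityMeasure X) ∈ range diracProba}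
  have hclosed : IsClosed D :=
    (isCompact_range continuous_diracProba).isClosed.preimage continuous_subtype_val
  rw [hclosed.isNowhereDense_iff, eq_empty_iff_forall_notMem]
  rintro ⟨μ, hμ⟩ hint
  obtain ⟨p, rfl⟩ : μ ∈ range diracProba := interior_subset (s := D) hint
  obtain ⟨ν, hν, hνp⟩ : ∃ ν ∈ invariantMeasures T, ν ≠ diracProba p := by
    by_contra! hall
    exact hne p (eq_singleton_iff_unique_mem.2 ⟨hμ, hall⟩)
  let γ (t : I) : invariantMeasures T :=
    ⟨segmentMeasure (diracProba p) ν t, segmentMeasure_mem_invariantMeasures hμ hν t⟩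
  have hγ : Continuous γ := (continuous_segmentMeasure _ ν).subtype_mk _
  have hγ0 : γ 0 = ⟨diracProba p, hμ⟩ := Subtype.ext (segmentMeasure_zero _ ν)
  have hdirac : ∀ᶠ t in 𝓝 (0 : I), γ t ∈ D :=
    hγ.continuousAt.eventually (mem_interior_iff_mem_nhds.1 (hγ0 ▸ hint))
  obtain ⟨t, ⟨ht, ht1⟩, ht0⟩ :=
    (((hdirac.and (eventually_ne_nhds zero_ne_one)).filter_mono nhdsWithin_le_nhds).and
      (eventually_mem_nhdsWithin (s := {0}ᶜ))).exists
  exact hνp (eq_of_segmentMeasure_mem_range_diracProba ht0 ht1 ht).symm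

section Transitive

theorem exists_mem_invariantMeasures_measure_ne_zero_of_forall_exists_iterate_mem {X : Type*}
    [TopologicalSpace X] [T2Space X] [CompactSpace X] [MeasurableSpace X] [BorelSpace X]
    [HasOuterApproxClosed X] {T : X → X} (hT : Continuous T) {D : Set X} (hD : IsClosed D)
    {y : X} {n : ℕ} (hy : ∀ j, ∃ i ≤ n, T^[i + j] y ∈ D) :
    ∃ ν ∈ invariantMeasures T, (ν : Measure X) D ≠ 0 := by
  obtain ⟨ν, hν, hsupp⟩ := exists_mem_invariantMeasures_of_orbit hT y
  refine ⟨ν, hν, fun hνD => ?_⟩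
  have hvisit : ∀ᵐ z ∂(ν : Measure X), z ∈ ⋃ i ∈ Finset.range (n + 1), T^[i] ⁻¹' D := by
    refine hsupp _ (isClosed_biUnion_finset fun i _ => hD.preimage (hT.iterate i)) fun j => ?_
    obtain ⟨i, hin, hi⟩ := hy j
    rw [Function.iterate_add_apply] at hi
    exact mem_biUnion (Finset.mem_range_succ_iff.2 hin) hi
  have hnull : (ν : Measure X) (⋃ i ∈ Finset.range (n + 1), T^[i] ⁻¹' D) = 0 := by
    refine (measure_biUnion_null_iff (Finset.countable_toSet _)).2 fun i _ => ?_
    rw [(MeasurePreserving.iterate hν i).measure_preimage hD.nullMeasurableSet, hνD]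
  obtain ⟨z, hz, hz'⟩ := (hvisit.and (measure_eq_zero_iff_ae_notMem.1 hnull)).exists
  exact hz' hz

variable {X : Type*} [MetricSpace X] [CompactSpace X] [MeasurableSpace X] [BorelSpace X]
  {T : X → X}

theorem IsTransitive.exists_mem_invariantMeasures_measure_ne_zero (htrans : IsTransitive T)
    (hT : Continuous T) (hshadow : HasShadowing T) {U : Set X} (hU : IsOpen U)
    (hUne : U.Nonempty) : ∃ ν ∈ invariantMeasures T, (ν : Measure X) U ≠ 0 := by
  obtain ⟨p, hp⟩ := hUne
  obtain ⟨r, hr, hrU⟩ := Metric.isOpen_iff.1 hU p hp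
  obtain ⟨δ, hδ, hclose⟩ := hshadow.exists_isTracedBy_mod (ε := r / 4) (by positivity)
  set V := Metric.ball p (min (r / 4) (δ / 2))
  have hpV : V.Nonempty := ⟨p, Metric.mem_ball_self (by positivity)⟩
  obtain ⟨n, hn, -, ⟨u, hu, rfl⟩, hu'⟩ := htrans V V Metric.isOpen_ball hpV Metric.isOpen_ball hpV
  rw [Metric.mem_ball, lt_min_iff] at hu hu'
  obtain ⟨y, hy⟩ := hclose u n hn.ne' (by linarith [dist_triangle_right (T^[n] u) u p])
  have hreturn (j : ℕ) : T^[n - j % n + j] y ∈ Metric.closedBall p (r / 2) := by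
    have hmod : (n - j % n + j) % n = 0 := by
      rw [← Nat.add_mod_mod, Nat.sub_add_cancel (Nat.mod_lt j hn).le, Nat.mod_self]
    have htrace : dist (T^[n - j % n + j] y) u < r / 4 := by
      simpa only [hmod, Function.iterate_zero, id] using hy (n - j % n + j)
    rw [Metric.mem_closedBall]
    linarith [dist_triangle (T^[n - j % n + j] y) u p]
  obtain ⟨ν, hν, hνp⟩ := exists_mem_invariantMeasures_measure_ne_zero_of_forall_exists_iterate_mem
    hT Metric.isClosed_closedBall fun j => ⟨n - j % n, Nat.sub_le _ _, hreturn j⟩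
  refine ⟨ν, hν, fun hνU => hνp (measure_mono_null ?_ hνU)⟩
  exact (Metric.closedBall_subset_ball (half_lt_self hr)).trans hrU

theorem IsTransitive.invariantMeasures_ne_singleton_diracProba [Nontrivial X]
    (htrans : IsTransitive T) (hT : Continuous T) (hshadow : HasShadowing T) (p : X) :
    invariantMeasures T ≠ {diracProba p} := by
  intro heq
  obtain ⟨ν, hν, hνp⟩ := htrans.exists_mem_invariantMeasures_measure_ne_zero hT hshadow
    (isOpen_compl_singleton (x := p)) (exists_ne p)
  rw [heq] at hν
  obtain rfl : ν = diracProba p := hν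
  exact hνp ((Measure.dirac_apply' p (measurableSet_singleton p).compl).trans (by simp))

end Transitive

end TopDyn

theorem mainTheorem9_general {X : Type*} [MetricSpace X] [CompactSpace X] [MeasurableSpace X]
    [BorelSpace X] (T : X → X) (hT : Continuous T) (hshadow : TopDyn.HasShadowing T)
    (hne : ∀ p, TopDyn.invariantMeasures T ≠ {diracProba p}) :
    IsMeagre {μ : TopDyn.invariantMeasures T |
      TopDyn.IsStronglyMixing T ((μ : ProbabilityMeasure X) : Measure X)} := by
  have hdirac := (TopDyn.isNowhereDense_setOf_mem_range_diracProba hne).isMeagre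
  have hother := TopDyn.isMeagre_setOf_isStronglyMixing_notMem_range_diracProba hT hshadow
  refine (hdirac.union hother).mono fun μ hμ => ?_
  exact (em _).imp_right fun hμdirac => ⟨hμ, hμdirac⟩

theorem mainTheorem9 {X : Type*} [MetricSpace X] [CompactSpace X] [Nontrivial X]
    [MeasurableSpace X] [BorelSpace X] (T : X → X) (hT : Continuous T)
    (htrans : TopDyn.IsTransitive T) (hshadow : TopDyn.HasShadowing T) :
    IsMeagre {μ : TopDyn.invariantMeasures T |
      TopDyn.IsStronglyMixing T ((μ : ProbabilityMeasure X) : Measure X)} :=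
  mainTheorem9_general T hT hshadow (htrans.invariantMeasures_ne_singleton_diracProba hT hshadow)
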